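/- **Theorem 2.1.** Let $\mathbb{T}_1,\mathbb{T}_2\subseteq\mathbb{R}$ be time scales (nonempty closed sets) with at least two points each, let $x_0\in\mathbb{T}_1$, $y_0\in\mathbb{T}_2$, let $I=[a,b]$ be a compact real interval, and put $H=\mathbb{T}_1\times\mathbb{T}_2\times I$. Let $u,p_1,p_2,f:H\to[0,\infty)$ be rd-continuous, meaning: in each variable separately, they are continuous at right-dense points and have finite left-sided limits at left-dense points, and they are bounded on bounded subsets of $H$. Suppose that $$u(x,y,z)\le p_1(x,y,z)+p_2(x,y,z)\int_{x_0}^x\int_{y_0}^y\int_a^b f(s,\tau,q)\,u(s,\tau,q)\,\Delta q\,\Delta\tau\,\Delta s$$ for all $(x,y,z)\in H$ with $x\ge x_0$ and $y\ge y_0$. Then, for all $(x,y,z)\in H$ with $x\ge x_0$ and $y\ge y_0$, $$u(x,y,z)\le p_1(x,y,z)+p_2(x,y,z)\,C(x,y)\,e_{Q(\cdot,y)}(x,x_0),$$ where $$C(x,y)=\int_{x_0}^x\int_{y_0}^y\int_a^b f(s,\tau,q)\,p_1(s,\tau,q)\,\Delta q\,\Delta\tau\,\Delta s,\qquad Q(s,y)=\int_{y_0}^y\int_a^b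 f(s,\tau,q)\,p_2(s,\tau,q)\,\Delta q\,\Delta\tau .$$ Here the integrals are (iterated) delta integrals, the variable $q$ running through the real interval $[a,b]$, and $e_p(\cdot,x_0)$ is the exponential function of the time scale $\mathbb{T}_1$, i.e. $e_p(x,x_0)=\exp\left(\int_{x_0}^x\xi_{\mu(s)}(p(s))\,\Delta s\right)$ with $\mu$ the graininess of $\mathbb{T}_1$, $\xi_h(w)=\log(1+hw)/h$ for $h\neq0$ and $\xi_0(w)=w$. -/

import Mathlib

open Set Filter Topology

namespace TimeScale

/-- A time scale: a nonempty closed subset of the real line. -/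
def IsTimeScale (T : Set ℝ) : Prop := T.Nonempty ∧ IsClosed T

/-- The set of points of `T` lying strictly to the right of `t`. -/
def after (T : Set ℝ) (t : ℝ) : Set ℝ := {s | s ∈ T ∧ t < s}

/-- The set of points of `T` lying strictly to the left of `t`. -/
def before (T : Set ℝ) (t : ℝ) : Set ℝ := {s | s ∈ T ∧ s < t}

open Classical in
/-- Forward jump operator `σ(t) = inf {s ∈ T : s > t}`, with `σ(t) = t` at the maximum of `T`. -/
noncomputable def sigma (T : Set ℝ) (t : ℝ) : ℝ :=
  if (after T t).Nonempty then sInf (after T t) else t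

open Classical in
/-- Backward jump operator `ρ(t) = sup {s ∈ T : s < t}`, with `ρ(t) = t` at the minimum of `T`. -/
noncomputable def rho (T : Set ℝ) (t : ℝ) : ℝ :=
  if (before T t).Nonempty then sSup (before T t) else t

/-- Graininess `μ(t) = σ(t) - t`. -/
noncomputable def graininess (T : Set ℝ) (t : ℝ) : ℝ := sigma T t - t

/-- `t < sup T` and `σ(t) = t`. -/
def RightDense (T : Set ℝ) (t : ℝ) : Prop := (after T t).Nonempty ∧ sigma T t = t

/-- `inf T < t` and `ρ(t) = t`. -/
def LeftDense (T : Set ℝ) (t : ℝ) : Prop := (before T t).Nonempty ∧ rho T t = t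

/-- `f : T → ℝ` is rd-continuous: continuous at right-dense points of `T`, with a finite left-sided
limit at left-dense points of `T`. Only the values of `f` on `T` matter. -/
def RdContinuous (T : Set ℝ) (f : ℝ → ℝ) : Prop :=
  ∀ t ∈ T, (RightDense T t → ContinuousWithinAt f T t) ∧
    (LeftDense T t → ∃ l : ℝ, Tendsto f (𝓝[T ∩ Iio t] t) (𝓝 l))

/-- Rd-continuity on `T₁ × T₂ × T₃`: rd-continuous in each variable separately, and bounded on
bounded subsets of `T₁ × T₂ × T₃`. For closed `T₁, T₂, T₃` every function that is continuous on the
product belongs to this class. -/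
structure RdContinuous₃ (T₁ T₂ T₃ : Set ℝ) (f : ℝ → ℝ → ℝ → ℝ) : Prop where
  fst : ∀ y ∈ T₂, ∀ z ∈ T₃, RdContinuous T₁ (fun x => f x y z)
  snd : ∀ x ∈ T₁, ∀ z ∈ T₃, RdContinuous T₂ (fun y => f x y z)
  thd : ∀ x ∈ T₁, ∀ y ∈ T₂, RdContinuous T₃ (fun z => f x y z)
  bdd : ∀ R : ℝ, ∃ M : ℝ, ∀ x ∈ T₁, ∀ y ∈ T₂, ∀ z ∈ T₃,
    |x| ≤ R → |y| ≤ R → |z| ≤ R → |f x y z| ≤ M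

/-- `F` has delta derivative `d` at `t`. -/
def HasDeltaDerivAt (T : Set ℝ) (F : ℝ → ℝ) (d t : ℝ) : Prop :=
  ∀ ε > 0, ∃ δ > 0, ∀ s ∈ T, |s - t| < δ →
    |F (sigma T t) - F s - d * (sigma T t - s)| ≤ ε * |sigma T t - s|

/-- `F` is a delta antiderivative of `f` on `T`: it is continuous on `T` and `F^Δ = f` at every
point of `T` except possibly the maximum of `T` (at a left-dense maximum an rd-continuous `f` need
not be continuous, so there one only asks that `F` be continuous). -/
def IsDeltaAntideriv (T : Set ℝ) (F f : ℝ → ℝ) : Prop :=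
  ContinuousOn F T ∧ ∀ t ∈ T, (after T t).Nonempty → HasDeltaDerivAt T F (f t) t

open Classical in
/-- The (Cauchy) delta integral `∫_s^t f(τ) Δτ = F(t) - F(s)`, where `F` is any delta antiderivative
of `f` on `T` (unique on `T` up to a constant; it exists when `f` is rd-continuous). -/
noncomputable def deltaIntegral (T : Set ℝ) (f : ℝ → ℝ) (s t : ℝ) : ℝ :=
  if h : ∃ F : ℝ → ℝ, IsDeltaAntideriv T F f then h.choose t - h.choose s else 0

/-- The cylinder transformation `ξ_h(z) = log(1 + h z) / h` for `h ≠ 0`, and `ξ_0(z) = z`. -/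
noncomputable def cylinder (h z : ℝ) : ℝ :=
  if h = 0 then z else Real.log (1 + h * z) / h

/-- The time scale exponential `e_p(t, s) = exp (∫_s^t ξ_{μ(τ)}(p(τ)) Δτ)`, for an rd-continuous
`p` which is positively regressive, i.e. `1 + μ p > 0` on `T` (for instance `p ≥ 0`). -/
noncomputable def deltaExp (T : Set ℝ) (p : ℝ → ℝ) (t s : ℝ) : ℝ :=
  Real.exp (deltaIntegral T (fun τ => cylinder (graininess T τ) (p τ)) s t)

/-- The iterated integral `∫_{y₀}^y ∫_a^b g(s,τ,q) Δq Δτ`, as a function of `s`; the variable `q`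
runs through the real interval `[a,b]`. -/
noncomputable def integral₂ (T₂ : Set ℝ) (a b y₀ : ℝ) (g : ℝ → ℝ → ℝ → ℝ) (y s : ℝ) : ℝ :=
  deltaIntegral T₂ (fun τ => deltaIntegral (Icc a b) (fun q => g s τ q) a b) y₀ y

/-- The iterated integral `∫_{x₀}^x ∫_{y₀}^y ∫_a^b g(s,τ,q) Δq Δτ Δs`. -/
noncomputable def integral₃ (T₁ T₂ : Set ℝ) (a b x₀ y₀ : ℝ) (g : ℝ → ℝ → ℝ → ℝ) (x y : ℝ) : ℝ :=
  deltaIntegral T₁ (fun s => integral₂ T₂ a b y₀ g y s) x₀ x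

end TimeScale

/-!
The delta integral of a function `f` on a time scale `T` is the Lebesgue integral of its step-like
extension `f ∘ floorPt T`, which equals `f t` on each gap `[t, σ t)`. This extension is
right-continuous as soon as `f` is continuous at right-dense points (`measurable_comp_floorPt`), so
it is measurable, and its integral is a delta antiderivative of `f`
(`IsIntegrand.isDeltaAntideriv`). Antiderivatives are unique up to a constant because a function
that does not increase across gaps and has nonpositive derivative at right-dense points is
nonincreasing (`le_of_hasDerivWithinAt_nonpos`, by induction along the time scale). Hence
`IsIntegrand.deltaIntegral_eq`. Bounded convergence then shows that integrating out one variable of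
a separately continuous, locally bounded function gives an integrand in the remaining variables
(`IsIntegrand₂.isIntegrand_deltaIntegral`), so every iterated integral in the theorem is a genuine
one.

Fix `y` and let `V s` be the triple integral of `f u` over `[x₀, s] × [y₀, y] × [a, b]`. It is
monotone in `y`, so inserting the assumed bound on `u` into its own integral gives
`V t ≤ C(x, y) + ∫ Q V` for `t ≤ x`, with `Q = Q(·, y)`. The function `R = C(x, y) + ∫ Q V`
satisfies `R^Δ = Q V ≤ Q R`, while `e = e_Q(·, x₀)` satisfies `e(σ t) = (1 + μ Q) e(t)` across gaps
and `e' = Q e` at right-dense points; hence `R / e` is nonincreasing and `V x ≤ C(x, y) e(x)`. This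
is Grönwall's inequality `le_mul_deltaExp`.
-/

namespace TimeScale

/-! ### Jump operators -/

lemma bddBelow_after (T : Set ℝ) (t : ℝ) : BddBelow (after T t) := ⟨t, fun _ hs => hs.2.le⟩

lemma le_sigma (T : Set ℝ) (t : ℝ) : t ≤ sigma T t := by
  unfold sigma
  split_ifs with h
  · exact le_csInf h fun s hs => hs.2.le
  · exact le_rfl

lemma sigma_le {T : Set ℝ} {s t : ℝ} (hs : s ∈ T) (hts : t < s) : sigma T t ≤ s := by
  have h : (after T t).Nonempty := ⟨s, hs, hts⟩
  rw [sigma, if_pos h]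
  exact csInf_le (bddBelow_after T t) ⟨hs, hts⟩

lemma sigma_mem {T : Set ℝ} (hT : IsTimeScale T) {t : ℝ} (ht : t ∈ T) : sigma T t ∈ T := by
  unfold sigma
  split_ifs with h
  · have := csInf_mem_closure h (bddBelow_after T t)
    exact hT.2.closure_subset (closure_mono (fun s hs => hs.1) this)
  · exact ht

lemma after_nonempty_of_lt_sigma {T : Set ℝ} {t : ℝ} (h : t < sigma T t) :
    (after T t).Nonempty := by
  by_contra hne
  rw [sigma, if_neg hne] at h
  exact lt_irrefl _ h

lemma RightDense.exists_mem {T : Set ℝ} {t r : ℝ} (h : RightDense T t) (hr : t < r) :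
    ∃ s ∈ T, t < s ∧ s < r := by
  have h2 := h.2
  rw [sigma, if_pos h.1] at h2
  obtain ⟨s, hs, hsr⟩ := exists_lt_of_csInf_lt h.1 (h2.trans_lt hr)
  exact ⟨s, hs.1, hs.2, hsr⟩

lemma rightDense_of_forall_exists {T : Set ℝ} {t : ℝ}
    (h : ∀ r, t < r → ∃ s ∈ T, t < s ∧ s ≤ r) : RightDense T t := by
  obtain ⟨s, hs, hts, -⟩ := h (t + 1) (by linarith)
  refine ⟨⟨s, hs, hts⟩, le_antisymm (le_of_forall_gt_imp_ge_of_dense fun r hr => ?_) (le_sigma T t)⟩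
  obtain ⟨s', hs', hts', hsr⟩ := h r hr
  exact (sigma_le hs' hts').trans hsr

/-- Near a right-dense point the graininess tends to zero. -/
lemma RightDense.tendsto_graininess {T : Set ℝ} {t : ℝ} (h : RightDense T t) :
    Tendsto (graininess T) (𝓝[T] t) (𝓝 0) := by
  rw [Metric.tendsto_nhds]
  intro ε hε
  obtain ⟨s, hs, hts, hsε⟩ := h.exists_mem (show t < t + ε / 2 by linarith)
  have h1 : ∀ᶠ r in 𝓝[T] t, r ∈ Ioo (t - ε / 2) s :=
    mem_nhdsWithin_of_mem_nhds (Ioo_mem_nhds (by linarith) hts)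
  filter_upwards [h1] with r hr
  have h2 : sigma T r ≤ s := sigma_le hs hr.2
  have h3 := le_sigma T r
  rw [Real.dist_eq, sub_zero, graininess, abs_of_nonneg (by linarith)]
  linarith [hr.1]

/-! ### The largest point of the time scale below a real number -/

/-- The largest point of `T` not exceeding `r` (the junk value `sSup ∅ = 0` if there is none).
The function `f ∘ floorPt T` extends `f` from `T` to the real line, as the constant `f t` on each
gap `[t, σ t)`; its Lebesgue integral is the delta integral of `f`. -/
noncomputable def floorPt (T : Set ℝ) (r : ℝ) : ℝ := sSup (T ∩ Iic r)

lemma bddAbove_inter_Iic (T : Set ℝ) (r : ℝ) : BddAbove (T ∩ Iic r) := ⟨r, fun _ hs => hs.2⟩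

lemma le_floorPt {T : Set ℝ} {s r : ℝ} (hs : s ∈ T) (hsr : s ≤ r) : s ≤ floorPt T r :=
  le_csSup (bddAbove_inter_Iic T r) ⟨hs, hsr⟩

lemma floorPt_mem_inter {T : Set ℝ} (hT : IsTimeScale T) {s r : ℝ} (hs : s ∈ T) (hsr : s ≤ r) :
    floorPt T r ∈ T ∩ Iic r :=
  (hT.2.inter isClosed_Iic).csSup_mem ⟨s, hs, hsr⟩ (bddAbove_inter_Iic T r)

lemma floorPt_mem {T : Set ℝ} (hT : IsTimeScale T) {s r : ℝ} (hs : s ∈ T) (hsr : s ≤ r) :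
    floorPt T r ∈ T := (floorPt_mem_inter hT hs hsr).1

lemma floorPt_le {T : Set ℝ} (hT : IsTimeScale T) {s r : ℝ} (hs : s ∈ T) (hsr : s ≤ r) :
    floorPt T r ≤ r := (floorPt_mem_inter hT hs hsr).2

lemma floorPt_of_mem {T : Set ℝ} (hT : IsTimeScale T) {t : ℝ} (ht : t ∈ T) : floorPt T t = t :=
  le_antisymm (floorPt_le hT ht le_rfl) (le_floorPt ht le_rfl)

lemma floorPt_of_lt_sigma {T : Set ℝ} (hT : IsTimeScale T) {t r : ℝ} (ht : t ∈ T) (htr : t ≤ r)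
    (hr : r < sigma T t) : floorPt T r = t := by
  refine le_antisymm ?_ (le_floorPt ht htr)
  by_contra hlt
  push Not at hlt
  have := sigma_le (floorPt_mem hT ht htr) hlt
  linarith [floorPt_le hT ht htr]

lemma abs_le_of_mem_uIcc {c d r : ℝ} (hr : r ∈ uIcc c d) : |r| ≤ max |c| |d| := by
  rcases mem_uIcc.1 hr with h | h
  · exact abs_le_max_abs_abs h.1 h.2
  · exact max_comm |c| |d| ▸ abs_le_max_abs_abs h.1 h.2

lemma floorPt_mem_uIcc {T : Set ℝ} (hT : IsTimeScale T) {c d r : ℝ} (hc : c ∈ T) (hd : d ∈ T)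
    (hr : r ∈ uIcc c d) : floorPt T r ∈ T ∩ uIcc c d := by
  have hm : min c d ∈ T := by rcases min_choice c d with h | h <;> rw [h] <;> assumption
  exact ⟨floorPt_mem hT hm hr.1, le_floorPt hm hr.1, (floorPt_le hT hm hr.1).trans hr.2⟩

/-! ### Integrands -/

/-- The class of functions integrated below: continuous at the right-dense points of `T` and bounded
on bounded subsets of `T`. It contains the rd-continuous functions that are bounded on bounded
sets; left-sided limits play no role for the delta integral. -/
structure IsIntegrand (T : Set ℝ) (f : ℝ → ℝ) : Prop where
  cont : ∀ t ∈ T, RightDense T t → ContinuousWithinAt f T t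
  bdd : ∀ R : ℝ, ∃ M : ℝ, ∀ t ∈ T, |t| ≤ R → |f t| ≤ M

/-- A right-continuous function on the line is measurable: it is the pointwise limit of its
step-function approximations from the right. -/
lemma measurable_of_continuousWithinAt_Ioi {g : ℝ → ℝ}
    (hg : ∀ r, ContinuousWithinAt g (Ioi r) r) : Measurable g := by
  have hlim : ∀ r : ℝ, Tendsto (fun n : ℕ => ((⌊((n : ℝ) + 1) * r⌋ : ℝ) + 1) / ((n : ℝ) + 1)) atTop
      (𝓝[>] r) := by
    intro r
    have hlt : ∀ n : ℕ, r < ((⌊((n : ℝ) + 1) * r⌋ : ℝ) + 1) / ((n : ℝ) + 1) := by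
      intro n
      rw [lt_div_iff₀ (by positivity), mul_comm]
      exact Int.lt_floor_add_one _
    refine tendsto_nhdsWithin_iff.2 ⟨?_, Eventually.of_forall hlt⟩
    refine tendsto_of_tendsto_of_tendsto_of_le_of_le tendsto_const_nhds
      (h := fun n : ℕ => r + 1 / ((n : ℝ) + 1)) ?_ (fun n => (hlt n).le) ?_
    · simpa using tendsto_const_nhds.add (tendsto_one_div_add_atTop_nhds_zero_nat (𝕜 := ℝ))
    · intro n
      have hn : (0 : ℝ) < (n : ℝ) + 1 := by positivity
      have := Int.floor_le (((n : ℝ) + 1) * r)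
      change _ / _ ≤ r + 1 / _
      rw [div_le_iff₀ hn, add_mul r, one_div, inv_mul_cancel₀ hn.ne']
      linarith
  refine measurable_of_tendsto_metrizable
    (f := fun (n : ℕ) r => g (((⌊((n : ℝ) + 1) * r⌋ : ℝ) + 1) / ((n : ℝ) + 1))) ?_
    (tendsto_pi_nhds.2 fun r => Tendsto.comp (hg r) (hlim r))
  intro n
  have h1 : Measurable fun r : ℝ => ⌊((n : ℝ) + 1) * r⌋ := (measurable_const_mul _).floor
  exact (measurable_of_countable
    (fun k : ℤ => g (((k : ℝ) + 1) / ((n : ℝ) + 1)))).comp h1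

lemma measurable_comp_floorPt {T : Set ℝ} (hT : IsTimeScale T) {f : ℝ → ℝ}
    (hf : ∀ t ∈ T, RightDense T t → ContinuousWithinAt f T t) :
    Measurable fun r => f (floorPt T r) := by
  refine measurable_of_continuousWithinAt_Ioi fun r => ?_
  by_cases h : ∀ r', r < r' → ∃ s ∈ T, r < s ∧ s ≤ r'
  · have hrT : r ∈ T := by
      refine hT.2.closure_subset (Metric.mem_closure_iff.2 fun ε hε => ?_)
      obtain ⟨s, hs, h1, h2⟩ := h (r + ε / 2) (by linarith)
      refine ⟨s, hs, ?_⟩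
      rw [dist_comm, Real.dist_eq, abs_of_pos (by linarith)]
      linarith
    have hc := hf r hrT (rightDense_of_forall_exists h)
    have hfl : Tendsto (floorPt T) (𝓝[>] r) (𝓝[T] r) := by
      refine tendsto_nhdsWithin_iff.2 ⟨?_, ?_⟩
      · refine tendsto_of_tendsto_of_tendsto_of_le_of_le' tendsto_const_nhds
          (tendsto_id.mono_left nhdsWithin_le_nhds) ?_ ?_
        · filter_upwards [self_mem_nhdsWithin] with s hs using le_floorPt hrT (le_of_lt hs)
        · filter_upwards [self_mem_nhdsWithin] with s hs using floorPt_le hT hrT (le_of_lt hs)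
      · filter_upwards [self_mem_nhdsWithin] with s hs using floorPt_mem hT hrT (le_of_lt hs)
    change Tendsto _ _ (𝓝 (f (floorPt T r)))
    rw [floorPt_of_mem hT hrT]
    exact hc.tendsto.comp hfl
  · push Not at h
    obtain ⟨r', hr', hgap⟩ := h
    have : (fun s => f (floorPt T s)) =ᶠ[𝓝[>] r] fun _ => f (floorPt T r) := by
      filter_upwards [Ioo_mem_nhdsGT hr'] with s hs
      have : T ∩ Iic s = T ∩ Iic r := by
        ext q
        refine ⟨fun hq => ⟨hq.1, ?_⟩, fun hq => ⟨hq.1, le_trans hq.2 hs.1.le⟩⟩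
        by_contra hlt
        have h1 := hgap q hq.1 (not_le.1 hlt)
        have h2 : q ≤ s := hq.2
        linarith [hs.2]
      rw [floorPt, this, floorPt]
    exact tendsto_const_nhds.congr' this.symm

lemma IsIntegrand.intervalIntegrable {T : Set ℝ} (hT : IsTimeScale T) {f : ℝ → ℝ}
    (hf : IsIntegrand T f) {c d : ℝ} (hc : c ∈ T) (hd : d ∈ T) :
    IntervalIntegrable (fun r => f (floorPt T r)) MeasureTheory.volume c d := by
  obtain ⟨M, hM⟩ := hf.bdd (max |c| |d|)
  refine IntervalIntegrable.mono_fun' (g := fun _ => M) intervalIntegrable_const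
    (measurable_comp_floorPt hT hf.cont).aestronglyMeasurable ?_
  filter_upwards [MeasureTheory.ae_restrict_mem measurableSet_uIoc] with r hr
  obtain ⟨h1, h2⟩ := floorPt_mem_uIcc hT hc hd (uIoc_subset_uIcc hr)
  exact hM _ h1 (abs_le_of_mem_uIcc h2)

/-! ### Delta antiderivatives -/

lemma HasDeltaDerivAt.hasDerivWithinAt {T : Set ℝ} {F : ℝ → ℝ} {d t : ℝ}
    (h : HasDeltaDerivAt T F d t) (ht : sigma T t = t) : HasDerivWithinAt F d T t := by
  rw [hasDerivWithinAt_iff_isLittleO, Asymptotics.isLittleO_iff]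
  intro c hc
  obtain ⟨δ, hδ, hs⟩ := h c hc
  rw [ht] at hs
  filter_upwards [self_mem_nhdsWithin, mem_nhdsWithin_of_mem_nhds (Metric.ball_mem_nhds t hδ)]
    with s hsT hsδ
  have := hs s hsT hsδ
  rw [Real.norm_eq_abs, Real.norm_eq_abs, ← abs_neg, abs_sub_comm s t]
  convert this using 2
  rw [smul_eq_mul]
  ring

lemma HasDeltaDerivAt.sub_eq {T : Set ℝ} {F : ℝ → ℝ} {d t : ℝ} (h : HasDeltaDerivAt T F d t)
    (ht : t ∈ T) : F (sigma T t) - F t = d * (sigma T t - t) := by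
  rw [← sub_eq_zero, ← abs_nonpos_iff]
  refine le_of_forall_pos_le_add fun ε hε => ?_
  have hμ : 0 < |sigma T t - t| + 1 := by positivity
  obtain ⟨δ, hδ, hs⟩ := h (ε / (|sigma T t - t| + 1)) (by positivity)
  refine (hs t ht (by simpa using hδ)).trans ?_
  rw [zero_add, div_mul_eq_mul_div, div_le_iff₀ hμ]
  nlinarith [abs_nonneg (sigma T t - t)]

/-- A continuous function on a time scale that does not increase across gaps and has nonpositive
derivative at right-dense points is nonincreasing. -/
lemma le_of_hasDerivWithinAt_nonpos {T : Set ℝ} (hT : IsTimeScale T) {G : ℝ → ℝ} {c d : ℝ}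
    (hc : c ∈ T) (hd : d ∈ T) (hcd : c ≤ d) (hG : ContinuousOn G T)
    (hscat : ∀ t ∈ T, c ≤ t → t < d → t < sigma T t → G (sigma T t) ≤ G t)
    (hdense : ∀ t ∈ T, c ≤ t → t < d → RightDense T t →
      ∃ g ≤ 0, HasDerivWithinAt G g T t) :
    G d ≤ G c := by
  -- It suffices that `G d ≤ G c + ε (d - c)`, which propagates to the right by induction on the
  -- time scale.
  have key : ∀ ε > 0, G d ≤ G c + ε * (d - c) := by
    intro ε hε
    let S : Set ℝ := {r | r ∈ T ∧ G r ≤ G c + ε * (r - c)}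
    have hS : IsClosed S := hT.2.isClosed_le hG (by fun_prop)
    refine (IsClosed.mem_of_ge_of_forall_exists_gt (a := c) (b := d) (s := S)
      (hS.inter isClosed_Icc) ⟨hc, by simp⟩ hcd ?_).2
    rintro t ⟨⟨htT, htG⟩, hct, htd⟩
    have hσd := sigma_le hd htd
    rcases (le_sigma T t).lt_or_eq with hlt | heq
    · refine ⟨sigma T t, ⟨sigma_mem hT htT, ?_⟩, hlt, hσd⟩
      have := hscat t htT hct htd hlt
      nlinarith
    · have hrd : RightDense T t := ⟨⟨d, hd, htd⟩, heq.symm⟩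
      obtain ⟨g, hg, hder⟩ := hdense t htT hct htd hrd
      rw [hasDerivWithinAt_iff_isLittleO, Asymptotics.isLittleO_iff] at hder
      obtain ⟨δ, hδ, hs⟩ := Metric.mem_nhdsWithin_iff.1 (hder hε)
      obtain ⟨s, hsT, hts, hsr⟩ := hrd.exists_mem (show t < min (t + δ) d from
        lt_min (by linarith) htd)
      have hsδ : s < t + δ := hsr.trans_le (min_le_left _ _)
      have hsd : s < d := hsr.trans_le (min_le_right _ _)
      have h1 : ‖G s - G t - (s - t) • g‖ ≤ ε * ‖s - t‖ := by
        refine hs ⟨?_, hsT⟩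
        rw [Metric.mem_ball, Real.dist_eq, abs_of_pos (by linarith)]
        linarith
      rw [Real.norm_eq_abs, Real.norm_eq_abs, abs_of_pos (show 0 < s - t by linarith),
        smul_eq_mul] at h1
      have h2 := (le_abs_self _).trans h1
      exact ⟨s, ⟨hsT, by nlinarith⟩, hts, hsd.le⟩
  refine le_of_forall_pos_le_add fun ε hε => ?_
  have hμ : 0 < d - c + 1 := by linarith
  refine (key (ε / (d - c + 1)) (by positivity)).trans ?_
  have : ε / (d - c + 1) * (d - c) ≤ ε := by
    rw [div_mul_eq_mul_div, div_le_iff₀ hμ]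
    nlinarith
  linarith

lemma IsDeltaAntideriv.sub_le_sub {T : Set ℝ} (hT : IsTimeScale T) {F G f : ℝ → ℝ}
    (hF : IsDeltaAntideriv T F f) (hG : IsDeltaAntideriv T G f) {c d : ℝ} (hc : c ∈ T) (hd : d ∈ T)
    (hcd : c ≤ d) : F d - G d ≤ F c - G c := by
  refine le_of_hasDerivWithinAt_nonpos hT (G := fun r => F r - G r) hc hd hcd (hF.1.sub hG.1) ?_ ?_
  · intro t ht _ _ hlt
    have hne := after_nonempty_of_lt_sigma hlt
    have h1 := (hF.2 t ht hne).sub_eq ht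
    have h2 := (hG.2 t ht hne).sub_eq ht
    linarith
  · intro t ht _ _ hrd
    exact ⟨0, le_rfl, by
      simpa using ((hF.2 t ht hrd.1).hasDerivWithinAt hrd.2).fun_sub
        ((hG.2 t ht hrd.1).hasDerivWithinAt hrd.2)⟩

lemma IsDeltaAntideriv.sub_eq_sub {T : Set ℝ} (hT : IsTimeScale T) {F G f : ℝ → ℝ}
    (hF : IsDeltaAntideriv T F f) (hG : IsDeltaAntideriv T G f) {c d : ℝ} (hc : c ∈ T)
    (hd : d ∈ T) : F d - F c = G d - G c := by
  rcases le_total c d with h | h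
  · linarith [hF.sub_le_sub hT hG hc hd h, hG.sub_le_sub hT hF hc hd h]
  · linarith [hF.sub_le_sub hT hG hd hc h, hG.sub_le_sub hT hF hd hc h]

lemma deltaIntegral_eq_sub {T : Set ℝ} (hT : IsTimeScale T) {F f : ℝ → ℝ}
    (hF : IsDeltaAntideriv T F f) {c d : ℝ} (hc : c ∈ T) (hd : d ∈ T) :
    deltaIntegral T f c d = F d - F c := by
  have h : ∃ F : ℝ → ℝ, IsDeltaAntideriv T F f := ⟨F, hF⟩
  rw [deltaIntegral, dif_pos h]
  exact h.choose_spec.sub_eq_sub hT hF hc hd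

/-! ### The delta integral as a Lebesgue integral -/

lemma abs_integral_comp_floorPt_le {T : Set ℝ} (hT : IsTimeScale T) {f : ℝ → ℝ} {c d M : ℝ}
    (hc : c ∈ T) (hd : d ∈ T) (hM : ∀ t ∈ T ∩ uIcc c d, |f t| ≤ M) :
    |∫ r in c..d, f (floorPt T r)| ≤ M * |d - c| := by
  rw [← Real.norm_eq_abs]
  exact intervalIntegral.norm_integral_le_of_norm_le_const fun _ hr =>
    hM _ (floorPt_mem_uIcc hT hc hd (uIoc_subset_uIcc hr))

lemma integral_comp_floorPt_sigma {T : Set ℝ} (hT : IsTimeScale T) (f : ℝ → ℝ) {t : ℝ}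
    (ht : t ∈ T) : ∫ r in t..sigma T t, f (floorPt T r) = f t * (sigma T t - t) := by
  rw [intervalIntegral.integral_congr_uIoo (g := fun _ => f t)]
  · rw [intervalIntegral.integral_const, smul_eq_mul, mul_comm]
  · intro r hr
    rw [uIoo_of_le (le_sigma T t)] at hr
    simp only [floorPt_of_lt_sigma hT ht hr.1.le hr.2]

/-- The fundamental theorem of calculus on a time scale. -/
lemma IsIntegrand.isDeltaAntideriv {T : Set ℝ} (hT : IsTimeScale T) {f : ℝ → ℝ}
    (hf : IsIntegrand T f) {c : ℝ} (hc : c ∈ T) :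
    IsDeltaAntideriv T (fun t => ∫ r in c..t, f (floorPt T r)) f := by
  have hint : ∀ s ∈ T, ∀ t ∈ T,
      IntervalIntegrable (fun r => f (floorPt T r)) MeasureTheory.volume s t :=
    fun s hs t ht => hf.intervalIntegrable hT hs ht
  have hsub : ∀ s ∈ T, ∀ t ∈ T, (∫ r in c..t, f (floorPt T r)) - ∫ r in c..s, f (floorPt T r) =
      ∫ r in s..t, f (floorPt T r) := fun s hs t ht =>
    intervalIntegral.integral_interval_sub_left (hint c hc t ht) (hint c hc s hs)
  have hcont : ContinuousOn (fun t => ∫ r in c..t, f (floorPt T r)) T := by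
    intro t ht
    obtain ⟨M, hM⟩ := hf.bdd (|t| + 1)
    have hlim : Tendsto (fun s => M * |s - t|) (𝓝[T] t) (𝓝 0) := by
      have : Continuous fun s : ℝ => M * |s - t| := by fun_prop
      simpa using (this.tendsto t).mono_left nhdsWithin_le_nhds
    refine tendsto_iff_norm_sub_tendsto_zero.2 (squeeze_zero' (Eventually.of_forall fun _ =>
      norm_nonneg _) ?_ hlim)
    filter_upwards [self_mem_nhdsWithin, mem_nhdsWithin_of_mem_nhds (Metric.ball_mem_nhds t one_pos)]
      with s hs hst
    rw [hsub t ht s hs]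
    refine abs_integral_comp_floorPt_le hT ht hs fun q hq => hM q hq.1 ?_
    refine (abs_le_of_mem_uIcc hq.2).trans (max_le (by linarith) ?_)
    rw [Metric.mem_ball, Real.dist_eq] at hst
    have := abs_sub_abs_le_abs_sub s t
    linarith
  refine ⟨hcont, fun t ht hne ε hε => ?_⟩
  rcases (le_sigma T t).lt_or_eq with hlt | heq
  · -- Across a gap the difference quotient is exact, and continuity of the integral suffices.
    have hσ : (∫ r in c..sigma T t, f (floorPt T r)) - ∫ r in c..t, f (floorPt T r) =
        f t * (sigma T t - t) := by
      rw [hsub t ht _ (sigma_mem hT ht), integral_comp_floorPt_sigma hT f ht]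
    have hlim : Tendsto (fun s => |(∫ r in c..sigma T t, f (floorPt T r)) -
        (∫ r in c..s, f (floorPt T r)) - f t * (sigma T t - s)| - ε * |sigma T t - s|) (𝓝[T] t)
        (𝓝 (|(∫ r in c..sigma T t, f (floorPt T r)) -
        (∫ r in c..t, f (floorPt T r)) - f t * (sigma T t - t)| - ε * |sigma T t - t|)) := by
      have h1 := hcont t ht
      have h2 : ContinuousWithinAt (fun s : ℝ => s) T t := continuousWithinAt_id
      exact ((((continuousWithinAt_const.sub h1).sub
        (continuousWithinAt_const.mul (continuousWithinAt_const.sub h2))).abs).sub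
        (continuousWithinAt_const.mul (continuousWithinAt_const.sub h2).abs))
    rw [hσ, sub_self, abs_zero, zero_sub] at hlim
    have hneg : -(ε * |sigma T t - t|) < 0 := by
      have : 0 < |sigma T t - t| := abs_pos.2 (by linarith)
      have := mul_pos hε this
      linarith
    obtain ⟨δ, hδ, h⟩ := Metric.mem_nhdsWithin_iff.1 (hlim.eventually (gt_mem_nhds hneg))
    refine ⟨δ, hδ, fun s hs hst => ?_⟩
    have := h ⟨hst, hs⟩
    simp only [mem_ofPred_eq] at this
    linarith
  · have hc' := hf.cont t ht ⟨hne, heq.symm⟩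
    obtain ⟨δ, hδ, h⟩ := Metric.continuousWithinAt_iff.1 hc' ε hε
    refine ⟨δ, hδ, fun s hs hst => ?_⟩
    rw [← heq, hsub s hs t ht]
    have hconst : f t * (t - s) = ∫ _ in s..t, f t := by
      rw [intervalIntegral.integral_const, smul_eq_mul, mul_comm]
    rw [hconst, ← intervalIntegral.integral_sub (hint s hs t ht) intervalIntegrable_const]
    refine abs_integral_comp_floorPt_le (f := fun q => f q - f t) hT hs ht fun q hq => ?_
    refine (h hq.1 ?_).le
    rw [Real.dist_eq]
    refine lt_of_le_of_lt ?_ hst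
    rw [abs_sub_comm q, abs_sub_comm s]
    exact abs_sub_right_of_mem_uIcc hq.2

lemma IsIntegrand.deltaIntegral_eq {T : Set ℝ} (hT : IsTimeScale T) {f : ℝ → ℝ}
    (hf : IsIntegrand T f) {c d : ℝ} (hc : c ∈ T) (hd : d ∈ T) :
    deltaIntegral T f c d = ∫ r in c..d, f (floorPt T r) := by
  rw [deltaIntegral_eq_sub hT (hf.isDeltaAntideriv hT hc) hc hd]
  simp

/-! ### Elementary properties of the delta integral -/

lemma IsIntegrand.add {T : Set ℝ} {f g : ℝ → ℝ} (hf : IsIntegrand T f) (hg : IsIntegrand T g) :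
    IsIntegrand T fun t => f t + g t where
  cont t ht h := (hf.cont t ht h).add (hg.cont t ht h)
  bdd R := by
    obtain ⟨M, hM⟩ := hf.bdd R
    obtain ⟨N, hN⟩ := hg.bdd R
    exact ⟨M + N, fun t ht h => (abs_add_le _ _).trans (add_le_add (hM t ht h) (hN t ht h))⟩

lemma IsIntegrand.mul {T : Set ℝ} {f g : ℝ → ℝ} (hf : IsIntegrand T f) (hg : IsIntegrand T g) :
    IsIntegrand T fun t => f t * g t where
  cont t ht h := (hf.cont t ht h).mul (hg.cont t ht h)
  bdd R := by
    obtain ⟨M, hM⟩ := hf.bdd R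
    obtain ⟨N, hN⟩ := hg.bdd R
    refine ⟨M * N, fun t ht h => ?_⟩
    rw [abs_mul]
    exact mul_le_mul (hM t ht h) (hN t ht h) (abs_nonneg _) ((abs_nonneg _).trans (hM t ht h))

lemma isIntegrand_const (T : Set ℝ) (k : ℝ) : IsIntegrand T fun _ => k where
  cont _ _ _ := continuousWithinAt_const
  bdd _ := ⟨|k|, fun _ _ _ => le_rfl⟩

lemma IsIntegrand.abs_deltaIntegral_le {T : Set ℝ} (hT : IsTimeScale T) {f : ℝ → ℝ} {c d M : ℝ}
    (hf : IsIntegrand T f) (hc : c ∈ T) (hd : d ∈ T) (hM : ∀ t ∈ T ∩ uIcc c d, |f t| ≤ M) :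
    |deltaIntegral T f c d| ≤ M * |d - c| := by
  rw [hf.deltaIntegral_eq hT hc hd]
  exact abs_integral_comp_floorPt_le hT hc hd hM

lemma IsIntegrand.deltaIntegral_mono {T : Set ℝ} (hT : IsTimeScale T) {f g : ℝ → ℝ} {c d : ℝ}
    (hf : IsIntegrand T f) (hg : IsIntegrand T g) (hc : c ∈ T) (hd : d ∈ T) (hcd : c ≤ d)
    (hfg : ∀ t ∈ T, c ≤ t → t ≤ d → f t ≤ g t) :
    deltaIntegral T f c d ≤ deltaIntegral T g c d := by
  rw [hf.deltaIntegral_eq hT hc hd, hg.deltaIntegral_eq hT hc hd]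
  refine intervalIntegral.integral_mono_on hcd (hf.intervalIntegrable hT hc hd)
    (hg.intervalIntegrable hT hc hd) fun r hr => ?_
  exact hfg _ (floorPt_mem hT hc hr.1) (le_floorPt hc hr.1) ((floorPt_le hT hc hr.1).trans hr.2)

lemma IsIntegrand.deltaIntegral_nonneg {T : Set ℝ} (hT : IsTimeScale T) {f : ℝ → ℝ} {c d : ℝ}
    (hf : IsIntegrand T f) (hc : c ∈ T) (hd : d ∈ T) (hcd : c ≤ d)
    (h0 : ∀ t ∈ T, c ≤ t → t ≤ d → 0 ≤ f t) : 0 ≤ deltaIntegral T f c d := by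
  rw [hf.deltaIntegral_eq hT hc hd]
  exact intervalIntegral.integral_nonneg hcd fun r hr =>
    h0 _ (floorPt_mem hT hc hr.1) (le_floorPt hc hr.1) ((floorPt_le hT hc hr.1).trans hr.2)

lemma IsIntegrand.deltaIntegral_add_mul {T : Set ℝ} (hT : IsTimeScale T) {f g : ℝ → ℝ} {c d : ℝ}
    (hf : IsIntegrand T f) (hg : IsIntegrand T g) (hc : c ∈ T) (hd : d ∈ T) (k : ℝ) :
    deltaIntegral T (fun t => f t + g t * k) c d =
      deltaIntegral T f c d + deltaIntegral T g c d * k := by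
  have hgk : IsIntegrand T fun t => g t * k := hg.mul (isIntegrand_const T k)
  rw [hf.deltaIntegral_eq hT hc hd, hg.deltaIntegral_eq hT hc hd,
    (hf.add hgk).deltaIntegral_eq hT hc hd, intervalIntegral.integral_add
    (hf.intervalIntegrable hT hc hd) (hgk.intervalIntegrable hT hc hd),
    intervalIntegral.integral_mul_const]

lemma IsIntegrand.deltaIntegral_le_right {T : Set ℝ} (hT : IsTimeScale T) {f : ℝ → ℝ} {c d e : ℝ}
    (hf : IsIntegrand T f) (hc : c ∈ T) (hd : d ∈ T) (he : e ∈ T) (hcd : c ≤ d) (hde : d ≤ e)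
    (h0 : ∀ t ∈ T, c ≤ t → 0 ≤ f t) : deltaIntegral T f c d ≤ deltaIntegral T f c e := by
  have h1 := hf.deltaIntegral_nonneg hT hd he hde fun t ht hdt _ => h0 t ht (hcd.trans hdt)
  rw [hf.deltaIntegral_eq hT hd he] at h1
  rw [hf.deltaIntegral_eq hT hc hd, hf.deltaIntegral_eq hT hc he,
    ← intervalIntegral.integral_add_adjacent_intervals (hf.intervalIntegrable hT hc hd)
    (hf.intervalIntegrable hT hd he)]
  linarith

lemma IsIntegrand.isDeltaAntideriv_deltaIntegral {T : Set ℝ} (hT : IsTimeScale T) {f : ℝ → ℝ}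
    (hf : IsIntegrand T f) {c : ℝ} (hc : c ∈ T) :
    IsDeltaAntideriv T (fun t => deltaIntegral T f c t) f := by
  have hF := hf.isDeltaAntideriv hT hc
  have heq : ∀ t ∈ T, deltaIntegral T f c t = ∫ r in c..t, f (floorPt T r) :=
    fun t ht => hf.deltaIntegral_eq hT hc ht
  refine ⟨hF.1.congr heq, fun t ht hne ε hε => ?_⟩
  obtain ⟨δ, hδ, h⟩ := hF.2 t ht hne ε hε
  refine ⟨δ, hδ, fun s hs hst => ?_⟩
  have := h s hs hst
  beta_reduce at this ⊢
  rwa [← heq s hs, ← heq _ (sigma_mem hT ht)] at this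

/-- The indefinite delta integral of an integrand is again an integrand. -/
lemma IsIntegrand.deltaIntegral {T : Set ℝ} (hT : IsTimeScale T) {f : ℝ → ℝ}
    (hf : IsIntegrand T f) {c : ℝ} (hc : c ∈ T) :
    IsIntegrand T fun t => deltaIntegral T f c t where
  cont t ht _ := (hf.isDeltaAntideriv_deltaIntegral hT hc).1 t ht
  bdd R := by
    obtain ⟨M, hM⟩ := hf.bdd (max |c| R)
    refine ⟨M * (R + |c|), fun t ht htR => ?_⟩
    have hM0 : 0 ≤ M := (abs_nonneg _).trans (hM c hc (le_max_left _ _))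
    refine (hf.abs_deltaIntegral_le hT hc ht fun q hq => hM q hq.1
      ((abs_le_of_mem_uIcc hq.2).trans (max_le_max le_rfl htR))).trans ?_
    exact mul_le_mul_of_nonneg_left ((abs_sub _ _).trans (by linarith)) hM0

/-! ### Functions of several variables and iterated integrals -/

/-- The two-variable analogue of `IsIntegrand`: the continuity condition holds in each variable
separately, and the bound holds jointly on bounded sets. -/
structure IsIntegrand₂ (S T : Set ℝ) (g : ℝ → ℝ → ℝ) : Prop where
  fst : ∀ t ∈ T, ∀ s ∈ S, RightDense S s → ContinuousWithinAt (fun s => g s t) S s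
  snd : ∀ s ∈ S, ∀ t ∈ T, RightDense T t → ContinuousWithinAt (g s) T t
  bdd : ∀ R : ℝ, ∃ M : ℝ, ∀ s ∈ S, ∀ t ∈ T, |s| ≤ R → |t| ≤ R → |g s t| ≤ M

/-- The three-variable analogue of `IsIntegrand`. -/
structure IsIntegrand₃ (T₁ T₂ T₃ : Set ℝ) (g : ℝ → ℝ → ℝ → ℝ) : Prop where
  fst : ∀ y ∈ T₂, ∀ z ∈ T₃, ∀ x ∈ T₁, RightDense T₁ x →
    ContinuousWithinAt (fun x => g x y z) T₁ x
  snd : ∀ x ∈ T₁, ∀ z ∈ T₃, ∀ y ∈ T₂, RightDense T₂ y →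
    ContinuousWithinAt (fun y => g x y z) T₂ y
  thd : ∀ x ∈ T₁, ∀ y ∈ T₂, ∀ z ∈ T₃, RightDense T₃ z → ContinuousWithinAt (g x y) T₃ z
  bdd : ∀ R : ℝ, ∃ M : ℝ, ∀ x ∈ T₁, ∀ y ∈ T₂, ∀ z ∈ T₃,
    |x| ≤ R → |y| ≤ R → |z| ≤ R → |g x y z| ≤ M

lemma RdContinuous₃.isIntegrand₃ {T₁ T₂ T₃ : Set ℝ} {g : ℝ → ℝ → ℝ → ℝ}
    (hg : RdContinuous₃ T₁ T₂ T₃ g) : IsIntegrand₃ T₁ T₂ T₃ g where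
  fst y hy z hz x hx := (hg.fst y hy z hz x hx).1
  snd x hx z hz y hy := (hg.snd x hx z hz y hy).1
  thd x hx y hy z hz := (hg.thd x hx y hy z hz).1
  bdd := hg.bdd

lemma IsIntegrand₃.mul {T₁ T₂ T₃ : Set ℝ} {f g : ℝ → ℝ → ℝ → ℝ} (hf : IsIntegrand₃ T₁ T₂ T₃ f)
    (hg : IsIntegrand₃ T₁ T₂ T₃ g) : IsIntegrand₃ T₁ T₂ T₃ fun x y z => f x y z * g x y z where
  fst y hy z hz x hx h := (hf.fst y hy z hz x hx h).mul (hg.fst y hy z hz x hx h)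
  snd x hx z hz y hy h := (hf.snd x hx z hz y hy h).mul (hg.snd x hx z hz y hy h)
  thd x hx y hy z hz h := (hf.thd x hx y hy z hz h).mul (hg.thd x hx y hy z hz h)
  bdd R := by
    obtain ⟨M, hM⟩ := hf.bdd R
    obtain ⟨N, hN⟩ := hg.bdd R
    refine ⟨M * N, fun x hx y hy z hz h1 h2 h3 => ?_⟩
    have h := hM x hx y hy z hz h1 h2 h3
    rw [abs_mul]
    exact mul_le_mul h (hN x hx y hy z hz h1 h2 h3) (abs_nonneg _) ((abs_nonneg _).trans h)

lemma IsIntegrand₂.isIntegrand_snd {S T : Set ℝ} {g : ℝ → ℝ → ℝ} (hg : IsIntegrand₂ S T g) {s : ℝ}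
    (hs : s ∈ S) : IsIntegrand T (g s) where
  cont := hg.snd s hs
  bdd R := by
    obtain ⟨M, hM⟩ := hg.bdd (max |s| R)
    exact ⟨M, fun t ht h => hM s hs t ht (le_max_left _ _) (h.trans (le_max_right _ _))⟩

lemma IsIntegrand₃.isIntegrand₂_snd_thd {T₁ T₂ T₃ : Set ℝ} {g : ℝ → ℝ → ℝ → ℝ}
    (hg : IsIntegrand₃ T₁ T₂ T₃ g) {x : ℝ} (hx : x ∈ T₁) : IsIntegrand₂ T₂ T₃ (g x) where
  fst := hg.snd x hx
  snd := hg.thd x hx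
  bdd R := by
    obtain ⟨M, hM⟩ := hg.bdd (max |x| R)
    exact ⟨M, fun y hy z hz h1 h2 => hM x hx y hy z hz (le_max_left _ _)
      (h1.trans (le_max_right _ _)) (h2.trans (le_max_right _ _))⟩

lemma IsIntegrand₃.isIntegrand₂_fst_thd {T₁ T₂ T₃ : Set ℝ} {g : ℝ → ℝ → ℝ → ℝ}
    (hg : IsIntegrand₃ T₁ T₂ T₃ g) {y : ℝ} (hy : y ∈ T₂) :
    IsIntegrand₂ T₁ T₃ fun x z => g x y z where
  fst := hg.fst y hy
  snd x hx := hg.thd x hx y hy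
  bdd R := by
    obtain ⟨M, hM⟩ := hg.bdd (max |y| R)
    exact ⟨M, fun x hx z hz h1 h2 => hM x hx y hy z hz (h1.trans (le_max_right _ _))
      (le_max_left _ _) (h2.trans (le_max_right _ _))⟩

/-- Integrating out the second variable gives an integrand in the first: continuity at right-dense
points is preserved by bounded convergence. -/
lemma IsIntegrand₂.isIntegrand_deltaIntegral {S T : Set ℝ} (hT : IsTimeScale T) {g : ℝ → ℝ → ℝ}
    (hg : IsIntegrand₂ S T g) {c d : ℝ} (hc : c ∈ T) (hd : d ∈ T) :
    IsIntegrand S fun s => TimeScale.deltaIntegral T (g s) c d where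
  cont s hs hrd := by
    have heq : ∀ s ∈ S, TimeScale.deltaIntegral T (g s) c d = ∫ r in c..d, g s (floorPt T r) :=
      fun s hs => (hg.isIntegrand_snd hs).deltaIntegral_eq hT hc hd
    refine ContinuousWithinAt.congr ?_ heq (heq s hs)
    obtain ⟨M, hM⟩ := hg.bdd (max (|s| + 1) (max |c| |d|))
    refine intervalIntegral.continuousWithinAt_of_dominated_interval (bound := fun _ => M) ?_ ?_
      intervalIntegrable_const ?_
    · filter_upwards [self_mem_nhdsWithin] with s' hs'
      exact (measurable_comp_floorPt hT (hg.snd s' hs')).aestronglyMeasurable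
    · filter_upwards [self_mem_nhdsWithin,
        mem_nhdsWithin_of_mem_nhds (Metric.ball_mem_nhds s one_pos)] with s' hs' hss'
      refine Eventually.of_forall fun r hr => ?_
      obtain ⟨h1, h2⟩ := floorPt_mem_uIcc hT hc hd (uIoc_subset_uIcc hr)
      refine hM s' hs' _ h1 (le_max_of_le_left ?_) (le_max_of_le_right (abs_le_of_mem_uIcc h2))
      rw [Metric.mem_ball, Real.dist_eq] at hss'
      linarith [abs_sub_abs_le_abs_sub s' s]
    · refine Eventually.of_forall fun r hr => ?_
      exact hg.fst _ (floorPt_mem_uIcc hT hc hd (uIoc_subset_uIcc hr)).1 s hs hrd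
  bdd R := by
    obtain ⟨M, hM⟩ := hg.bdd (max R (max |c| |d|))
    exact ⟨M * |d - c|, fun s hs hsR =>
      (hg.isIntegrand_snd hs).abs_deltaIntegral_le hT hc hd fun q hq =>
        hM s hs q hq.1 (le_max_of_le_left hsR) (le_max_of_le_right (abs_le_of_mem_uIcc hq.2))⟩

lemma IsIntegrand₃.isIntegrand₂_deltaIntegral {T₁ T₂ T₃ : Set ℝ} (hT₃ : IsTimeScale T₃)
    {g : ℝ → ℝ → ℝ → ℝ} (hg : IsIntegrand₃ T₁ T₂ T₃ g) {c d : ℝ} (hc : c ∈ T₃) (hd : d ∈ T₃) :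
    IsIntegrand₂ T₁ T₂ fun x y => deltaIntegral T₃ (g x y) c d where
  fst y hy := ((hg.isIntegrand₂_fst_thd hy).isIntegrand_deltaIntegral hT₃ hc hd).cont
  snd x hx := ((hg.isIntegrand₂_snd_thd hx).isIntegrand_deltaIntegral hT₃ hc hd).cont
  bdd R := by
    obtain ⟨M, hM⟩ := hg.bdd (max R (max |c| |d|))
    exact ⟨M * |d - c|, fun x hx y hy h1 h2 =>
      ((hg.isIntegrand₂_snd_thd hx).isIntegrand_snd hy).abs_deltaIntegral_le hT₃ hc hd fun q hq =>
        hM x hx y hy q hq.1 (le_max_of_le_left h1) (le_max_of_le_left h2)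
          (le_max_of_le_right (abs_le_of_mem_uIcc hq.2))⟩

lemma isTimeScale_Icc {a b : ℝ} (hab : a ≤ b) : IsTimeScale (Icc a b) :=
  ⟨nonempty_Icc.2 hab, isClosed_Icc⟩

section IteratedIntegral

variable {T₁ T₂ : Set ℝ} {a b y₀ : ℝ} {g : ℝ → ℝ → ℝ → ℝ}

lemma IsIntegrand₃.isIntegrand₂_integral (hab : a ≤ b) (hg : IsIntegrand₃ T₁ T₂ (Icc a b) g) :
    IsIntegrand₂ T₁ T₂ fun x y => deltaIntegral (Icc a b) (g x y) a b :=
  hg.isIntegrand₂_deltaIntegral (isTimeScale_Icc hab) (left_mem_Icc.2 hab) (right_mem_Icc.2 hab)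

lemma IsIntegrand₃.isIntegrand_integral₂ (hT₂ : IsTimeScale T₂) (hab : a ≤ b) (hy₀ : y₀ ∈ T₂)
    (hg : IsIntegrand₃ T₁ T₂ (Icc a b) g) {y : ℝ} (hy : y ∈ T₂) :
    IsIntegrand T₁ (integral₂ T₂ a b y₀ g y) :=
  (hg.isIntegrand₂_integral hab).isIntegrand_deltaIntegral hT₂ hy₀ hy

lemma IsIntegrand₃.isIntegrand_thd (hg : IsIntegrand₃ T₁ T₂ (Icc a b) g) {x y : ℝ} (hx : x ∈ T₁)
    (hy : y ∈ T₂) : IsIntegrand (Icc a b) (g x y) :=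
  (hg.isIntegrand₂_snd_thd hx).isIntegrand_snd hy

lemma IsIntegrand₃.integral_nonneg (hab : a ≤ b) (hg : IsIntegrand₃ T₁ T₂ (Icc a b) g) {x y : ℝ}
    (hx : x ∈ T₁) (hy : y ∈ T₂) (h0 : ∀ z ∈ Icc a b, 0 ≤ g x y z) :
    0 ≤ deltaIntegral (Icc a b) (g x y) a b :=
  (hg.isIntegrand_thd hx hy).deltaIntegral_nonneg (isTimeScale_Icc hab) (left_mem_Icc.2 hab)
    (right_mem_Icc.2 hab) hab fun z hz _ _ => h0 z hz

lemma IsIntegrand₃.integral₂_nonneg (hT₂ : IsTimeScale T₂) (hab : a ≤ b) (hy₀ : y₀ ∈ T₂)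
    (hg : IsIntegrand₃ T₁ T₂ (Icc a b) g) {x y : ℝ} (hx : x ∈ T₁) (hy : y ∈ T₂) (hy₀y : y₀ ≤ y)
    (h0 : ∀ y ∈ T₂, ∀ z ∈ Icc a b, 0 ≤ g x y z) : 0 ≤ integral₂ T₂ a b y₀ g y x :=
  ((hg.isIntegrand₂_integral hab).isIntegrand_snd hx).deltaIntegral_nonneg hT₂ hy₀ hy hy₀y
    fun τ hτ _ _ => hg.integral_nonneg hab hx hτ (h0 τ hτ)

lemma IsIntegrand₃.integral₂_mono_right (hT₂ : IsTimeScale T₂) (hab : a ≤ b) (hy₀ : y₀ ∈ T₂)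
    (hg : IsIntegrand₃ T₁ T₂ (Icc a b) g) {x y y' : ℝ} (hx : x ∈ T₁) (hy : y ∈ T₂) (hy' : y' ∈ T₂)
    (hy₀y : y₀ ≤ y) (hyy' : y ≤ y') (h0 : ∀ y ∈ T₂, ∀ z ∈ Icc a b, 0 ≤ g x y z) :
    integral₂ T₂ a b y₀ g y x ≤ integral₂ T₂ a b y₀ g y' x :=
  ((hg.isIntegrand₂_integral hab).isIntegrand_snd hx).deltaIntegral_le_right hT₂ hy₀ hy hy' hy₀y
    hyy' fun τ hτ _ => hg.integral_nonneg hab hx hτ (h0 τ hτ)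

lemma IsIntegrand₃.integral₃_mono_right {x₀ : ℝ} (hT₁ : IsTimeScale T₁) (hT₂ : IsTimeScale T₂)
    (hab : a ≤ b) (hx₀ : x₀ ∈ T₁) (hy₀ : y₀ ∈ T₂) (hg : IsIntegrand₃ T₁ T₂ (Icc a b) g)
    {x y y' : ℝ} (hx : x ∈ T₁) (hx₀x : x₀ ≤ x) (hy : y ∈ T₂) (hy' : y' ∈ T₂) (hy₀y : y₀ ≤ y)
    (hyy' : y ≤ y') (h0 : ∀ x ∈ T₁, ∀ y ∈ T₂, ∀ z ∈ Icc a b, 0 ≤ g x y z) :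
    integral₃ T₁ T₂ a b x₀ y₀ g x y ≤ integral₃ T₁ T₂ a b x₀ y₀ g x y' :=
  (hg.isIntegrand_integral₂ hT₂ hab hy₀ hy).deltaIntegral_mono hT₁
    (hg.isIntegrand_integral₂ hT₂ hab hy₀ hy') hx₀ hx hx₀x fun s hs _ _ =>
    hg.integral₂_mono_right hT₂ hab hy₀ hs hy hy' hy₀y hyy' (h0 s hs)

/-- If `g ≤ g₁ + g₂ k` on the fibre over `x`, with `k` constant, then the double integrals over that
fibre satisfy the same inequality. -/
lemma IsIntegrand₃.integral₂_le_add_mul {g₁ g₂ : ℝ → ℝ → ℝ → ℝ} (hT₂ : IsTimeScale T₂) (hab : a ≤ b)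
    (hy₀ : y₀ ∈ T₂) (hg : IsIntegrand₃ T₁ T₂ (Icc a b) g)
    (hg₁ : IsIntegrand₃ T₁ T₂ (Icc a b) g₁) (hg₂ : IsIntegrand₃ T₁ T₂ (Icc a b) g₂) {x y k : ℝ}
    (hx : x ∈ T₁) (hy : y ∈ T₂) (hy₀y : y₀ ≤ y)
    (hle : ∀ τ ∈ T₂, y₀ ≤ τ → τ ≤ y → ∀ z ∈ Icc a b, g x τ z ≤ g₁ x τ z + g₂ x τ z * k) :
    integral₂ T₂ a b y₀ g y x ≤ integral₂ T₂ a b y₀ g₁ y x + integral₂ T₂ a b y₀ g₂ y x * k := by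
  have h1 := (hg₁.isIntegrand₂_integral hab).isIntegrand_snd hx
  have h2 := (hg₂.isIntegrand₂_integral hab).isIntegrand_snd hx
  unfold integral₂
  rw [← h1.deltaIntegral_add_mul hT₂ h2 hy₀ hy]
  refine ((hg.isIntegrand₂_integral hab).isIntegrand_snd hx).deltaIntegral_mono hT₂
    (h1.add (h2.mul (isIntegrand_const _ k))) hy₀ hy hy₀y fun τ hτ hy₀τ hτy => ?_
  have h3 := hg₁.isIntegrand_thd hx hτ
  have h4 := hg₂.isIntegrand_thd hx hτ
  have ha := left_mem_Icc.2 hab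
  have hb := right_mem_Icc.2 hab
  rw [← h3.deltaIntegral_add_mul (isTimeScale_Icc hab) h4 ha hb]
  exact (hg.isIntegrand_thd hx hτ).deltaIntegral_mono (isTimeScale_Icc hab)
    (h3.add (h4.mul (isIntegrand_const _ k))) ha hb hab fun z hz _ _ => hle τ hτ hy₀τ hτy z hz

end IteratedIntegral

/-! ### The exponential function and Grönwall's inequality -/

lemma cylinder_le {h w : ℝ} (hh : 0 ≤ h) (hw : 0 ≤ w) : cylinder h w ≤ w := by
  unfold cylinder
  split_ifs with h0
  · exact le_rfl
  · have hpos : 0 < h := lt_of_le_of_ne hh (Ne.symm h0)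
    rw [div_le_iff₀ hpos]
    have := Real.log_le_sub_one_of_pos (show 0 < 1 + h * w by positivity)
    linarith

lemma div_le_cylinder {h w : ℝ} (hh : 0 ≤ h) (hw : 0 ≤ w) : w / (1 + h * w) ≤ cylinder h w := by
  unfold cylinder
  split_ifs with h0
  · simp [h0]
  · have hpos : 0 < h := lt_of_le_of_ne hh (Ne.symm h0)
    have h1 : 0 < 1 + h * w := by positivity
    rw [le_div_iff₀ hpos]
    have := Real.one_sub_inv_le_log_of_pos h1
    refine le_trans (le_of_eq ?_) this
    field_simp
    ring

lemma graininess_nonneg (T : Set ℝ) (t : ℝ) : 0 ≤ graininess T t := sub_nonneg.2 (le_sigma T t)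

lemma exp_cylinder_mul {h w : ℝ} (hh : 0 < h) (hw : 0 ≤ w) :
    Real.exp (cylinder h w * h) = 1 + h * w := by
  rw [cylinder, if_neg hh.ne', div_mul_cancel₀ _ hh.ne', Real.exp_log (by positivity)]

/-- At a right-dense point the graininess tends to `0`, and `w / (1 + h w) ≤ ξ_h(w) ≤ w` squeezes
the cylinder transformation. -/
lemma IsIntegrand.cylinder {T : Set ℝ} {Q : ℝ → ℝ} (hQ : IsIntegrand T Q)
    (hQ0 : ∀ t ∈ T, 0 ≤ Q t) : IsIntegrand T fun t => cylinder (graininess T t) (Q t) where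
  cont t ht hrd := by
    have hμ : graininess T t = 0 := by rw [graininess, hrd.2, sub_self]
    have hc : Tendsto Q (𝓝[T] t) (𝓝 (Q t)) := hQ.cont t ht hrd
    have hlow : Tendsto (fun s => Q s / (1 + graininess T s * Q s)) (𝓝[T] t) (𝓝 (Q t)) := by
      have : Tendsto (fun s => Q s / (1 + graininess T s * Q s)) (𝓝[T] t)
          (𝓝 (Q t / (1 + 0 * Q t))) := hc.div (tendsto_const_nhds.add (hrd.tendsto_graininess.mul hc))
        (show (1 : ℝ) + 0 * Q t ≠ 0 by simp)
      simpa using this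
    change Tendsto _ _ (𝓝 (TimeScale.cylinder (graininess T t) (Q t)))
    rw [hμ, TimeScale.cylinder, if_pos rfl]
    refine tendsto_of_tendsto_of_tendsto_of_le_of_le' hlow hc ?_ ?_
    · filter_upwards [self_mem_nhdsWithin] with s hs
      exact div_le_cylinder (graininess_nonneg T s) (hQ0 s hs)
    · filter_upwards [self_mem_nhdsWithin] with s hs
      exact cylinder_le (graininess_nonneg T s) (hQ0 s hs)
  bdd R := by
    obtain ⟨M, hM⟩ := hQ.bdd R
    refine ⟨M, fun t ht htR => ?_⟩
    have h0 := hQ0 t ht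
    have hμ := graininess_nonneg T t
    have h1 : 0 ≤ TimeScale.cylinder (graininess T t) (Q t) :=
      le_trans (by positivity) (div_le_cylinder hμ h0)
    rw [abs_of_nonneg h1]
    exact (cylinder_le hμ h0).trans ((le_abs_self _).trans (hM t ht htR))

/-- Grönwall's inequality on a time scale. The right-hand side `K + ∫ Q V` of the hypothesis, divided
by the exponential function, is nonincreasing. -/
lemma le_mul_deltaExp {T : Set ℝ} (hT : IsTimeScale T) {Q V : ℝ → ℝ} (hQ : IsIntegrand T Q)
    (hV : IsIntegrand T V) (hQ0 : ∀ t ∈ T, 0 ≤ Q t) {x₀ x K : ℝ} (hx₀ : x₀ ∈ T) (hx : x ∈ T)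
    (hx₀x : x₀ ≤ x)
    (h : ∀ t ∈ T, x₀ ≤ t → t ≤ x → V t ≤ K + deltaIntegral T (fun s => Q s * V s) x₀ t) :
    V x ≤ K * deltaExp T Q x x₀ := by
  have hξ := hQ.cylinder hQ0
  obtain ⟨hAc, hAd⟩ := hξ.isDeltaAntideriv_deltaIntegral hT hx₀
  obtain ⟨hRc, hRd⟩ := (hQ.mul hV).isDeltaAntideriv_deltaIntegral hT hx₀
  unfold deltaExp
  set A : ℝ → ℝ := fun t =>
    deltaIntegral T (fun s => TimeScale.cylinder (graininess T s) (Q s)) x₀ t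
  set I : ℝ → ℝ := fun t => deltaIntegral T (fun s => Q s * V s) x₀ t
  have key : (K + I x) * Real.exp (-A x) ≤ (K + I x₀) * Real.exp (-A x₀) := by
    refine le_of_hasDerivWithinAt_nonpos hT (G := fun t => (K + I t) * Real.exp (-A t)) hx₀ hx hx₀x
      ((continuousOn_const.add hRc).mul hAc.neg.rexp) ?_ ?_
    · intro t ht h1 h2 hlt
      have hne := after_nonempty_of_lt_sigma hlt
      have hR := (hRd t ht hne).sub_eq ht
      have hE := (hAd t ht hne).sub_eq ht
      have hμ : 0 < graininess T t := sub_pos.2 hlt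
      have hfac : 0 < 1 + graininess T t * Q t := by
        have := mul_nonneg hμ.le (hQ0 t ht)
        linarith
      have hexp : Real.exp (A (sigma T t)) = Real.exp (A t) * (1 + graininess T t * Q t) := by
        rw [← exp_cylinder_mul hμ (hQ0 t ht), ← Real.exp_add]
        congr 1
        change A _ - A t = _ * graininess T t at hE
        linarith
      have hVt : V t ≤ K + I t := h t ht h1 h2.le
      change I _ - I t = _ * graininess T t at hR
      simp only [Real.exp_neg, hexp, mul_inv]
      rw [mul_comm (Real.exp (A t))⁻¹, ← mul_assoc]
      refine mul_le_mul_of_nonneg_right ?_ (by positivity)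
      rw [← div_eq_mul_inv, div_le_iff₀ hfac]
      nlinarith [mul_le_mul_of_nonneg_left hVt (mul_nonneg hμ.le (hQ0 t ht))]
    · intro t ht h1 h2 hrd
      have hR := (hRd t ht hrd.1).hasDerivWithinAt hrd.2
      have hE := (hAd t ht hrd.1).hasDerivWithinAt hrd.2
      have hμ : graininess T t = 0 := by rw [graininess, hrd.2, sub_self]
      beta_reduce at hR hE
      rw [hμ, TimeScale.cylinder, if_pos rfl] at hE
      refine ⟨_, ?_, (hR.const_add K).mul hE.fun_neg.exp⟩
      have hVt : V t ≤ K + I t := h t ht h1 h2.le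
      have h3 := mul_nonneg (mul_nonneg (hQ0 t ht) (sub_nonneg.2 hVt)) (Real.exp_pos (-A t)).le
      linarith
  have h0 : ∀ {f : ℝ → ℝ}, IsIntegrand T f → deltaIntegral T f x₀ x₀ = 0 := fun hf => by
    rw [hf.deltaIntegral_eq hT hx₀ hx₀, intervalIntegral.integral_same]
  have hI0 : I x₀ = 0 := h0 (hQ.mul hV)
  have hA0 : A x₀ = 0 := h0 hξ
  rw [hI0, hA0, neg_zero, Real.exp_zero, mul_one, add_zero, Real.exp_neg, ← div_eq_mul_inv,
    div_le_iff₀ (Real.exp_pos _)] at key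
  exact (h x hx hx₀x le_rfl).trans key

end TimeScale

/-! ### The integral inequality -/

theorem theorem2p1 (T₁ T₂ : Set ℝ)
    (hT₁ : TimeScale.IsTimeScale T₁) (hT₂ : TimeScale.IsTimeScale T₂)
    (hT₁' : T₁.Nontrivial) (hT₂' : T₂.Nontrivial)
    (a b : ℝ) (hab : a ≤ b) (x₀ y₀ : ℝ) (hx₀ : x₀ ∈ T₁) (hy₀ : y₀ ∈ T₂)
    (u p₁ p₂ f : ℝ → ℝ → ℝ → ℝ)
    (hu : TimeScale.RdContinuous₃ T₁ T₂ (Set.Icc a b) u)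
    (hp₁ : TimeScale.RdContinuous₃ T₁ T₂ (Set.Icc a b) p₁)
    (hp₂ : TimeScale.RdContinuous₃ T₁ T₂ (Set.Icc a b) p₂)
    (hf : TimeScale.RdContinuous₃ T₁ T₂ (Set.Icc a b) f)
    (hu0 : ∀ x ∈ T₁, ∀ y ∈ T₂, ∀ z ∈ Set.Icc a b, 0 ≤ u x y z)
    (hp₁0 : ∀ x ∈ T₁, ∀ y ∈ T₂, ∀ z ∈ Set.Icc a b, 0 ≤ p₁ x y z)
    (hp₂0 : ∀ x ∈ T₁, ∀ y ∈ T₂, ∀ z ∈ Set.Icc a b, 0 ≤ p₂ x y z)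
    (hf0 : ∀ x ∈ T₁, ∀ y ∈ T₂, ∀ z ∈ Set.Icc a b, 0 ≤ f x y z)
    (h : ∀ x ∈ T₁, ∀ y ∈ T₂, ∀ z ∈ Set.Icc a b, x₀ ≤ x → y₀ ≤ y →
      u x y z ≤ p₁ x y z + p₂ x y z *
        TimeScale.integral₃ T₁ T₂ a b x₀ y₀ (fun s τ q => f s τ q * u s τ q) x y) :
    ∀ x ∈ T₁, ∀ y ∈ T₂, ∀ z ∈ Set.Icc a b, x₀ ≤ x → y₀ ≤ y →
      u x y z ≤ p₁ x y z + p₂ x y z *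
        TimeScale.integral₃ T₁ T₂ a b x₀ y₀ (fun s τ q => f s τ q * p₁ s τ q) x y *
        TimeScale.deltaExp T₁
          (fun s => TimeScale.integral₂ T₂ a b y₀ (fun s τ q => f s τ q * p₂ s τ q) y s) x x₀ := by
  have hfu := hf.isIntegrand₃.mul hu.isIntegrand₃
  have hfp₁ := hf.isIntegrand₃.mul hp₁.isIntegrand₃
  have hfp₂ := hf.isIntegrand₃.mul hp₂.isIntegrand₃
  intro x hx y hy z hz hx₀x hy₀y
  have hJ := hfu.isIntegrand_integral₂ hT₂ hab hy₀ hy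
  have hJ₁ := hfp₁.isIntegrand_integral₂ hT₂ hab hy₀ hy
  have hQ := hfp₂.isIntegrand_integral₂ hT₂ hab hy₀ hy
  have hV := hJ.deltaIntegral hT₁ hx₀
  have hgronwall := TimeScale.le_mul_deltaExp hT₁ hQ hV
    (fun s hs => hfp₂.integral₂_nonneg hT₂ hab hy₀ hs hy hy₀y fun τ hτ q hq =>
      mul_nonneg (hf0 s hs τ hτ q hq) (hp₂0 s hs τ hτ q hq))
    (K := TimeScale.integral₃ T₁ T₂ a b x₀ y₀ (fun s τ q => f s τ q * p₁ s τ q) x y)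
    hx₀ hx hx₀x ?_
  · refine (h x hx y hy z hz hx₀x hy₀y).trans ?_
    rw [mul_assoc]
    have := mul_le_mul_of_nonneg_left hgronwall (hp₂0 x hx y hy z hz)
    exact add_le_add le_rfl this
  intro t ht hx₀t htx
  -- The integral of `f p₁` up to `t` is at most its integral `C(x, y)` up to `x`.
  have hC := hJ₁.deltaIntegral_le_right hT₁ hx₀ ht hx hx₀t htx fun s hs _ =>
    hfp₁.integral₂_nonneg hT₂ hab hy₀ hs hy hy₀y fun τ hτ q hq =>
      mul_nonneg (hf0 s hs τ hτ q hq) (hp₁0 s hs τ hτ q hq)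
  refine le_trans ?_ (add_le_add hC le_rfl)
  have hadd := hJ₁.deltaIntegral_add_mul hT₁ (hQ.mul hV) hx₀ ht 1
  simp only [mul_one] at hadd
  rw [← hadd]
  refine hJ.deltaIntegral_mono hT₁ (hJ₁.add (hQ.mul hV)) hx₀ ht hx₀t fun s hs hx₀s _ => ?_
  refine hfu.integral₂_le_add_mul hT₂ hab hy₀ hfp₁ hfp₂ hs hy hy₀y fun τ hτ hy₀τ hτy q hq => ?_
  -- The triple integral is monotone in `y`, so its value at `(s, τ)` is at most that at `(s, y)`.
  have hmono := hfu.integral₃_mono_right hT₁ hT₂ hab hx₀ hy₀ hs hx₀s hτ hy hy₀τ hτy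
    fun s hs τ hτ q hq => mul_nonneg (hf0 s hs τ hτ q hq) (hu0 s hs τ hτ q hq)
  have hle := (h s hs τ hτ q hq hx₀s hy₀τ).trans
    (add_le_add le_rfl (mul_le_mul_of_nonneg_left hmono (hp₂0 s hs τ hτ q hq)))
  have hfle := mul_le_mul_of_nonneg_left hle (hf0 s hs τ hτ q hq)
  rw [mul_add, ← mul_assoc] at hfle
  exact hfle
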